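/- Let $n,m$ be nonnegative integers, let $g_1,\dots,g_m\in\mathbb{R}[t_1,\dots,t_n]$ be nonzero polynomials and let $d_1,\dots,d_m$ be nonnegative integers; write $\mathbf{g}=(g_1,\dots,g_m)$ and $\mathbf{d}=(d_1,\dots,d_m)$. For an integer $r\ge 0$ let $\mathcal{V}_{n,r}$ be the space of real polynomials in $n$ variables of total degree at most $r$, and for an integer $d\ge 0$ let $\Sigma_{n,2d}\subset\mathcal{V}_{n,2d}$ be the set of finite sums $\sum_{j=1}^M q_j^2$ with $q_1,\dots,q_M\in\mathcal{V}_{n,d}$. Let \[ \mathcal{V}^{\mathbf{g}}_{n,2\mathbf{d}}=\Bigl\{\sum_{i=1}^m g_i r_i \;:\; r_i\in\mathcal{V}_{n,2d_i},\ i=1,\dots,m\Bigr\},\qquad \Sigma^{\mathbf{g}}_{n,2\mathbf{d}}=\Bigl\{\sum_{i=1}^m g_i s_i \;:\; s_i\in\Sigma_{n,2d_i},\ i=1,\dots,m\Bigr\}. \] A subset $K$ of a finite-dimensional real vector space $V$ is called a proper cone in $V$ if it is a closed convex cone (that is, closed, convex, and closed under multiplication by nonnegative reals), is pointed ($x\in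 K$ and $-x\in K$ imply $x=0$), and has nonempty interior in $V$, with respect to the usual topology of $V$. Then $\Sigma^{\mathbf{g}}_{n,2\mathbf{d}}$ is a proper cone in $\mathcal{V}^{\mathbf{g}}_{n,2\mathbf{d}}$ if and only if there are no polynomials $s_1\in\Sigma_{n,2d_1},\dots,s_m\in\Sigma_{n,2d_m}$ with \[ \sum_{i=1}^m g_i s_i=0\qquad\text{and}\qquad\sum_{i=1}^m s_i\neq 0 . \] -/

import Mathlib

/-- `V_{n,r}`: the space of real polynomials in `n` variables of total degree at most `r`. -/
noncomputable abbrev polySpace (n r : ℕ) : Submodule ℝ (MvPolynomial (Fin n) ℝ) :=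
  MvPolynomial.restrictTotalDegree (Fin n) ℝ r

/-- `Σ_{n,2d}`: the polynomials `p ∈ V_{n,2d}` of the form `q₁² + ⋯ + q_M²` for some
`M` and some `q₁, …, q_M ∈ V_{n,d}`. -/
def sosCone (n d : ℕ) : Set (MvPolynomial (Fin n) ℝ) :=
  {p | p ∈ polySpace n (2 * d) ∧
    ∃ (M : ℕ) (q : Fin M → MvPolynomial (Fin n) ℝ),
      (∀ j, q j ∈ polySpace n d) ∧ p = ∑ j, q j ^ 2}

/-- `V^g_{n,2d}`: the space of polynomials `∑ gᵢ rᵢ` with `rᵢ ∈ V_{n,2dᵢ}`. -/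
noncomputable def weightedSpace {n m : ℕ} (g : Fin m → MvPolynomial (Fin n) ℝ) (d : Fin m → ℕ) :
    Submodule ℝ (MvPolynomial (Fin n) ℝ) where
  carrier := {p | ∃ r : Fin m → MvPolynomial (Fin n) ℝ,
    (∀ i, r i ∈ polySpace n (2 * d i)) ∧ p = ∑ i, g i * r i}
  zero_mem' := ⟨0, fun _ => Submodule.zero_mem _, by simp⟩
  add_mem' := by
    rintro _ _ ⟨r, hr, rfl⟩ ⟨s, hs, rfl⟩
    exact ⟨r + s, fun i => Submodule.add_mem _ (hr i) (hs i), by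
      simp [mul_add, Finset.sum_add_distrib]⟩
  smul_mem' := by
    rintro c _ ⟨r, hr, rfl⟩
    exact ⟨c • r, fun i => Submodule.smul_mem _ c (hr i), by simp [Finset.smul_sum]⟩

/-- `Σ^g_{n,2d}`: the weighted sum-of-squares polynomials, i.e. the `p ∈ V^g_{n,2d}` of the
form `∑ gᵢ sᵢ` with `sᵢ ∈ Σ_{n,2dᵢ}`, as a subset of the space `V^g_{n,2d}`. -/
def wsosCone {n m : ℕ} (g : Fin m → MvPolynomial (Fin n) ℝ) (d : Fin m → ℕ) :
    Set (weightedSpace g d) :=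
  {p | ∃ s : Fin m → MvPolynomial (Fin n) ℝ,
    (∀ i, s i ∈ sosCone n (d i)) ∧ (p : MvPolynomial (Fin n) ℝ) = ∑ i, g i * s i}

/-- A proper cone in a finite-dimensional real vector space `E`: a closed convex cone that is
pointed (in the sense of conic optimization: it contains no line) and has nonempty interior.
Closedness and interior refer to the usual topology of `E`, i.e. the module topology, which on
a finite-dimensional real vector space is the unique Hausdorff vector space topology. -/
structure IsProperCone {E : Type*} [AddCommGroup E] [Module ℝ E] (K : Set E) : Prop where
  smul_mem : ∀ c : ℝ, 0 ≤ c → ∀ x ∈ K, c • x ∈ K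
  convex : Convex ℝ K
  isClosed : @IsClosed E (moduleTopology ℝ E) K
  pointed : ∀ x ∈ K, -x ∈ K → x = 0
  interior_nonempty : (@interior E (moduleTopology ℝ E) K).Nonempty

/-! The cone is generated by the products `g i * q ^ 2` with `q ≠ 0`. After positive rescaling `q`
runs over unit spheres, so a compact set `S` of generators suffices (`wsosCone_eq_span`). If `0` is
outside the convex hull of `S`, the cone is closed and pointed; it has interior points because
squares span (`polySpace_two_mul_le_span_sq`). If `0` is in the hull, it has a representation with
nonzero total, since sums of squares cannot cancel (`convex_nontrivial_wsos`). Conversely, if `∑ g i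
* s i = 0`, the cone contains each `g i * s i` and its negative, the sum of the other terms.
Pointedness and `g i ≠ 0` force `s i = 0`. -/

/-! ### Cones over compact sets. -/

/-- By Carathéodory, `finrank + 1` points suffice, so the hull is a continuous image of a simplex
times a power of `S`. -/
theorem IsCompact.convexHull_of_finiteDimensional {E : Type*} [NormedAddCommGroup E]
    [NormedSpace ℝ E] [FiniteDimensional ℝ E] {S : Set E} (hS : IsCompact S) :
    IsCompact (convexHull ℝ S) := by
  rcases S.eq_empty_or_nonempty with rfl | ⟨a, ha⟩
  · simp
  set N := Module.finrank ℝ E + 1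
  let f : (Fin N → ℝ) × (Fin N → E) → E := fun x => ∑ i, x.1 i • x.2 i
  have hf : Continuous f := by fun_prop
  have hc : IsCompact ((stdSimplex ℝ (Fin N)) ×ˢ (Set.univ.pi fun _ : Fin N => S)) :=
    (isCompact_stdSimplex ℝ (Fin N)).prod (isCompact_univ_pi fun _ => hS)
  convert! hc.image hf using 1
  ext x
  constructor
  · intro hx
    obtain ⟨ι, _, z, w, hz, hind, hw, hw1, rfl⟩ := eq_pos_convex_span_of_mem_convexHull hx
    have hcard : Fintype.card ι ≤ Fintype.card (Fin N) := by
      simpa using hind.card_le_finrank_succ.trans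
        (Nat.succ_le_succ (Submodule.finrank_le _))
    obtain ⟨e⟩ := Function.Embedding.nonempty_of_card_le hcard
    have hext : ∀ i, Function.extend e w (fun _ => 0) (e i) = w i :=
      fun i => e.injective.extend_apply _ _ _
    have hextz : ∀ i, Function.extend e z (fun _ => a) (e i) = z i :=
      fun i => e.injective.extend_apply _ _ _
    have hext0 : ∀ j, j ∉ Set.range e → Function.extend e w (fun _ => 0) j = 0 :=
      fun j hj => Function.extend_apply' _ _ _ hj
    -- Shorter combinations are padded with weight `0` at the point `a`.
    refine ⟨(Function.extend e w (fun _ => 0), Function.extend e z (fun _ => a)),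
      ⟨⟨fun j => ?_, ?_⟩, fun j _ => ?_⟩, ?_⟩
    · by_cases hj : j ∈ Set.range e
      · obtain ⟨i, rfl⟩ := hj
        exact (hw i).le.trans_eq (hext i).symm
      · exact (hext0 j hj).symm.le
    · rw [← hw1]
      exact (Fintype.sum_of_injective e e.injective _ _ hext0 fun i => (hext i).symm).symm
    · by_cases hj : j ∈ Set.range e
      · obtain ⟨i, rfl⟩ := hj
        exact Set.mem_of_eq_of_mem (hextz i) (hz ⟨i, rfl⟩)
      · exact Set.mem_of_eq_of_mem (Function.extend_apply' z (fun _ => a) j hj) ha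
    · refine (Fintype.sum_of_injective e e.injective _ _ (fun j hj => ?_) (fun i => ?_)).symm
      · simp only [hext0 j hj, zero_smul]
      · simp only [hext, hextz]
  · rintro ⟨⟨w, z⟩, ⟨hw, hz⟩, rfl⟩
    exact (convex_convexHull ℝ S).sum_mem (fun i _ => hw.1 i) hw.2
      (fun i _ => subset_convexHull ℝ S (hz i trivial))

/-- Along a subsequence the points of `T` converge to a nonzero `z`, so the coefficients, being
quotients of norms, converge too. A disc with `0` on its boundary shows that `0 ∉ T` matters. -/
theorem IsCompact.isClosed_nonneg_smul {E : Type*} [NormedAddCommGroup E] [NormedSpace ℝ E]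
    {T : Set E} (hT : IsCompact T) (h0 : (0 : E) ∉ T) :
    IsClosed {x : E | ∃ c : ℝ, 0 ≤ c ∧ ∃ y ∈ T, x = c • y} := by
  refine IsSeqClosed.isClosed fun u x hu hx => ?_
  choose c hc y hy hcy using hu
  obtain ⟨z, hz, φ, hφ, hyz⟩ := hT.tendsto_subseq hy
  have hz0 : ‖z‖ ≠ 0 := norm_ne_zero_iff.2 fun h => h0 (h ▸ hz)
  have hne : ∀ n, ‖y n‖ ≠ 0 := fun n => norm_ne_zero_iff.2 fun h => h0 (h ▸ hy n)
  have hlim : Filter.Tendsto (fun n => c (φ n)) Filter.atTop (nhds (‖x‖ / ‖z‖)) := by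
    have := ((hx.comp hφ.tendsto_atTop).norm).div hyz.norm hz0
    refine this.congr fun n => ?_
    simp only [Function.comp_apply, hcy, norm_smul, Real.norm_of_nonneg (hc _)]
    exact mul_div_cancel_right₀ _ (hne _)
  refine ⟨‖x‖ / ‖z‖, by positivity, z, hz, ?_⟩
  refine tendsto_nhds_unique (hx.comp hφ.tendsto_atTop) ((hlim.smul hyz).congr fun n => ?_)
  simp [hcy]

/-- For empty `S` the left side is `{0}` and the right side is empty. -/
theorem PointedCone.coe_span_eq_nonneg_smul_convexHull {E : Type*} [AddCommGroup E] [Module ℝ E]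
    {S : Set E} (hS : S.Nonempty) :
    (Submodule.span {c : ℝ // 0 ≤ c} S : Set E) =
      {x : E | ∃ c : ℝ, 0 ≤ c ∧ ∃ y ∈ convexHull ℝ S, x = c • y} := by
  ext x
  constructor
  · intro hx
    obtain ⟨a, ha⟩ := hS
    induction hx using Submodule.span_induction with
    | mem x hx => exact ⟨1, zero_le_one, x, subset_convexHull ℝ S hx, (one_smul _ _).symm⟩
    | zero => exact ⟨0, le_rfl, a, subset_convexHull ℝ S ha, (zero_smul _ _).symm⟩
    | add x y _ _ hx hy =>
      obtain ⟨c, hc, x, hx, rfl⟩ := hx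
      obtain ⟨c', hc', y, hy, rfl⟩ := hy
      rcases (add_nonneg hc hc').eq_or_lt with h | h
      · obtain ⟨rfl, rfl⟩ : c = 0 ∧ c' = 0 := by constructor <;> linarith
        exact ⟨0, le_rfl, x, hx, by simp⟩
      · refine ⟨c + c', h.le, (c / (c + c')) • x + (c' / (c + c')) • y,
          convex_convexHull ℝ S hx hy (by positivity) (by positivity) (by field_simp), ?_⟩
        rw [smul_add, smul_smul, smul_smul, mul_div_cancel₀ _ h.ne', mul_div_cancel₀ _ h.ne']
    | smul r x _ hx =>
      obtain ⟨c, hc, x, hx, rfl⟩ := hx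
      exact ⟨r * c, mul_nonneg r.2 hc, x, hx, by rw [mul_smul]; rfl⟩
  · rintro ⟨c, hc, y, hy, rfl⟩
    refine (Submodule.span {c : ℝ // 0 ≤ c} S).smul_mem (⟨c, hc⟩ : {c : ℝ // 0 ≤ c}) ?_
    refine convexHull_min Submodule.subset_span ?_ hy
    intro x hx y hy a b ha hb _
    exact add_mem (Submodule.smul_mem _ (⟨a, ha⟩ : {c : ℝ // 0 ≤ c}) hx)
      (Submodule.smul_mem _ (⟨b, hb⟩ : {c : ℝ // 0 ≤ c}) hy)

theorem Convex.interior_nonempty_of_span_eq_top {E : Type*} [NormedAddCommGroup E]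
    [NormedSpace ℝ E] [FiniteDimensional ℝ E] {K S : Set E} (hK : Convex ℝ K) (h0 : (0 : E) ∈ K)
    (hSK : S ⊆ K) (hspan : Submodule.span ℝ S = ⊤) : (interior K).Nonempty := by
  refine hK.interior_nonempty_iff_affineSpan_eq_top.2 ?_
  refine (AffineSubspace.affineSpan_eq_top_iff_vectorSpan_eq_top_of_nonempty ℝ E E ⟨0, h0⟩).2 ?_
  refine eq_top_iff.2 (hspan.symm.le.trans (Submodule.span_le.2 fun x hx => ?_))
  have := vsub_mem_vectorSpan ℝ (hSK hx) h0
  rwa [vsub_eq_sub, sub_zero] at this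

/-- In a finite-dimensional space, the cone spanned by a compact spanning set whose convex hull
avoids the origin is proper. -/
theorem isProperCone_span_of_isCompact {E : Type*} [NormedAddCommGroup E] [NormedSpace ℝ E]
    [FiniteDimensional ℝ E] {S : Set E} (hS : IsCompact S) (h0 : (0 : E) ∉ convexHull ℝ S)
    (hspan : Submodule.span ℝ S = ⊤) :
    IsProperCone (Submodule.span {c : ℝ // 0 ≤ c} S : Set E) := by
  have hmod : IsModuleTopology ℝ E := isModuleTopologyOfFiniteDimensional
  have hsmul : ∀ c : ℝ, 0 ≤ c → ∀ x ∈ Submodule.span {c : ℝ // 0 ≤ c} S,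
      c • x ∈ Submodule.span {c : ℝ // 0 ≤ c} S :=
    fun c hc x hx => Submodule.smul_mem _ (⟨c, hc⟩ : {c : ℝ // 0 ≤ c}) hx
  have hconv : Convex ℝ (Submodule.span {c : ℝ // 0 ≤ c} S : Set E) :=
    fun x hx y hy a b ha hb _ => add_mem (hsmul a ha x hx) (hsmul b hb y hy)
  have hzero : (0 : E) ∈ (Submodule.span {c : ℝ // 0 ≤ c} S : Set E) :=
    (Submodule.span {c : ℝ // 0 ≤ c} S).zero_mem
  have hsub : S ⊆ (Submodule.span {c : ℝ // 0 ≤ c} S : Set E) := Submodule.subset_span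
  have hint := hconv.interior_nonempty_of_span_eq_top hzero hsub hspan
  refine ⟨hsmul, hconv, ?_, ?_, ?_⟩
  · rw [← hmod.eq_moduleTopology']
    rcases S.eq_empty_or_nonempty with rfl | hne
    · simp
    · rw [PointedCone.coe_span_eq_nonneg_smul_convexHull hne]
      exact hS.convexHull_of_finiteDimensional.isClosed_nonneg_smul h0
  · rcases S.eq_empty_or_nonempty with rfl | hne
    · rw [Submodule.span_empty]
      exact fun x hx _ => hx
    · rw [PointedCone.coe_span_eq_nonneg_smul_convexHull hne]
      rintro x ⟨c, hc, y, hy, rfl⟩ ⟨c', hc', y', hy', h⟩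
      rcases (add_nonneg hc hc').eq_or_lt with h' | h'
      · obtain rfl : c = 0 := by linarith
        simp
      · refine absurd ?_ h0
        -- Normalizing `c • y + c' • y' = 0` puts `0` in the hull.
        have : (0 : E) = (c / (c + c')) • y + (c' / (c + c')) • y' := by
          rw [div_eq_inv_mul, div_eq_inv_mul, mul_smul, mul_smul, ← h]
          simp
        rw [this]
        exact convex_convexHull ℝ S hy hy' (by positivity) (by positivity) (by field_simp)
  · rw [← hmod.eq_moduleTopology']
    exact hint

/-! ### Diagonals of bilinear maps. -/

/-- The diagonal values of a bilinear map on nonzero vectors are, up to positive scaling, the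
points of a compact set. -/
theorem LinearMap.exists_isCompact_diagonal {V E : Type*} [AddCommGroup V] [Module ℝ V]
    [FiniteDimensional ℝ V] [NormedAddCommGroup E] [NormedSpace ℝ E] [FiniteDimensional ℝ E]
    (B : V →ₗ[ℝ] V →ₗ[ℝ] E) :
    ∃ S : Set E, IsCompact S ∧ (∀ x ∈ S, ∃ v, v ≠ 0 ∧ x = B v v) ∧
      ∀ v, v ≠ 0 → ∃ c : ℝ, 0 < c ∧ ∃ x ∈ S, B v v = c • x := by
  let e := (Module.finBasis ℝ V).equivFun
  have hmod : IsModuleTopology ℝ E := isModuleTopologyOfFiniteDimensional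
  let B' : (Fin (Module.finrank ℝ V) → ℝ) →ₗ[ℝ] (Fin (Module.finrank ℝ V) → ℝ) →ₗ[ℝ] E :=
    B.compl₁₂ e.symm.toLinearMap e.symm.toLinearMap
  have hB2 := IsModuleTopology.continuous_bilinear_of_finite_left B'
  have hB : Continuous fun v : Fin (Module.finrank ℝ V) → ℝ => B' v v :=
    Continuous.comp (g := fun p : (Fin (Module.finrank ℝ V) → ℝ) × (Fin (Module.finrank ℝ V) → ℝ) =>
      B' p.1 p.2) hB2 (f := fun v => (v, v)) (by fun_prop)
  refine ⟨(fun v => B' v v) '' Metric.sphere 0 1, (isCompact_sphere _ _).image hB, ?_, ?_⟩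
  · rintro _ ⟨v, hv, rfl⟩
    refine ⟨e.symm v, ?_, rfl⟩
    rw [Ne, LinearEquiv.map_eq_zero_iff]
    rintro rfl
    simp at hv
  · intro v hv
    have hev : e v ≠ 0 := by simpa using hv
    have hn : ‖e v‖ ≠ 0 := norm_ne_zero_iff.2 hev
    refine ⟨‖e v‖ * ‖e v‖, by positivity, _, ⟨‖e v‖⁻¹ • e v, ?_, rfl⟩, ?_⟩
    · simp [norm_smul, hn]
    · simp only [map_smul, LinearMap.smul_apply, smul_smul, B', LinearMap.compl₁₂_apply,
        LinearEquiv.coe_coe, LinearEquiv.symm_apply_apply]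
      rw [show ‖e v‖ * ‖e v‖ * (‖e v‖⁻¹ * ‖e v‖⁻¹) = 1 by field_simp, one_smul]

/-- The cone spanned by the diagonal values of finitely many bilinear maps is proper once these
values span the space and have no nontrivial vanishing convex combination. -/
theorem LinearMap.exists_isProperCone_span_diagonal {ι : Type*} [Finite ι] {V : ι → Type*}
    [∀ i, AddCommGroup (V i)] [∀ i, Module ℝ (V i)] [∀ i, FiniteDimensional ℝ (V i)]
    {E : Type*} [AddCommGroup E] [Module ℝ E] [FiniteDimensional ℝ E]
    (B : ∀ i, V i →ₗ[ℝ] V i →ₗ[ℝ] E) :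
    ∃ S : Set E, (∀ x ∈ S, ∃ i v, v ≠ 0 ∧ x = B i v v) ∧
      (∀ i v, v ≠ 0 → ∃ c : ℝ, 0 < c ∧ ∃ x ∈ S, B i v v = c • x) ∧
      ((0 : E) ∉ convexHull ℝ S → Submodule.span ℝ S = ⊤ →
        IsProperCone (Submodule.span {c : ℝ // 0 ≤ c} S : Set E)) := by
  let e := (Module.finBasis ℝ E).equivFun
  -- Any norm will do: `IsProperCone` refers only to the module topology.
  let : NormedAddCommGroup E := NormedAddCommGroup.induced _ _ e.toLinearMap e.injective
  let : NormedSpace ℝ E := NormedSpace.induced ℝ _ _ e.toLinearMap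
  choose S hSc hS1 hS2 using fun i => (B i).exists_isCompact_diagonal
  refine ⟨⋃ i, S i, fun x hx => ?_, fun i v hv => ?_,
    fun h0 hspan => isProperCone_span_of_isCompact (isCompact_iUnion hSc) h0 hspan⟩
  · obtain ⟨i, hi⟩ := Set.mem_iUnion.1 hx
    exact ⟨i, hS1 i x hi⟩
  · obtain ⟨c, hc, x, hx, h⟩ := hS2 i v hv
    exact ⟨c, hc, x, Set.mem_iUnion.2 ⟨i, hx⟩, h⟩

/-! ### Sums of squares. -/

open MvPolynomial in
theorem eval_nonneg_of_mem_sosCone {n d : ℕ} {p : MvPolynomial (Fin n) ℝ} (hp : p ∈ sosCone n d)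
    (x : Fin n → ℝ) : 0 ≤ eval x p := by
  obtain ⟨-, M, q, -, rfl⟩ := hp
  simpa only [map_sum, map_pow] using Finset.sum_nonneg fun j _ => sq_nonneg (eval x (q j))

theorem zero_mem_sosCone (n d : ℕ) : (0 : MvPolynomial (Fin n) ℝ) ∈ sosCone n d :=
  ⟨Submodule.zero_mem _, 0, 0, fun j => j.elim0, by simp⟩

theorem add_mem_sosCone {n d : ℕ} {p q : MvPolynomial (Fin n) ℝ} (hp : p ∈ sosCone n d)
    (hq : q ∈ sosCone n d) : p + q ∈ sosCone n d := by
  obtain ⟨hp, M, a, ha, rfl⟩ := hp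
  obtain ⟨hq, N, b, hb, rfl⟩ := hq
  refine ⟨Submodule.add_mem _ hp hq, M + N, Fin.append a b, fun j => ?_, ?_⟩
  · refine Fin.addCases (fun i => ?_) (fun i => ?_) j
    · simpa using ha i
    · simpa using hb i
  · simp [Fin.sum_univ_add]

theorem smul_mem_sosCone {n d : ℕ} {p : MvPolynomial (Fin n) ℝ} {c : ℝ} (hc : 0 ≤ c)
    (hp : p ∈ sosCone n d) : c • p ∈ sosCone n d := by
  obtain ⟨hp, M, a, ha, rfl⟩ := hp
  refine ⟨Submodule.smul_mem _ c hp, M, fun j => Real.sqrt c • a j,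
    fun j => Submodule.smul_mem _ _ (ha j), ?_⟩
  simp [Finset.smul_sum, smul_pow, Real.sq_sqrt hc]

theorem mul_mem_polySpace {n d : ℕ} {p q : MvPolynomial (Fin n) ℝ} (hp : p ∈ polySpace n d)
    (hq : q ∈ polySpace n d) : p * q ∈ polySpace n (2 * d) := by
  rw [MvPolynomial.mem_restrictTotalDegree] at *
  exact (MvPolynomial.totalDegree_mul p q).trans (by omega)

theorem sq_mem_sosCone {n d : ℕ} {q : MvPolynomial (Fin n) ℝ} (hq : q ∈ polySpace n d) :
    q * q ∈ sosCone n d :=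
  ⟨mul_mem_polySpace hq hq, 1, fun _ => q, fun _ => hq, by simp [sq]⟩

/-- A polynomial of degree at most `2 * d` is a linear combination of squares of polynomials of
degree at most `d`. -/
theorem polySpace_two_mul_le_span_sq (n d : ℕ) :
    polySpace n (2 * d) ≤
      Submodule.span ℝ {p | ∃ q ∈ polySpace n d, q ≠ 0 ∧ p = q * q} := by
  have hsq : ∀ q ∈ polySpace n d,
      q * q ∈ Submodule.span ℝ {p | ∃ q ∈ polySpace n d, q ≠ 0 ∧ p = q * q} := by
    intro q hq
    by_cases h : q = 0
    · simp [h]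
    · exact Submodule.subset_span ⟨q, hq, h, rfl⟩
  intro p hp
  rw [MvPolynomial.mem_restrictTotalDegree] at hp
  rw [← MvPolynomial.support_sum_monomial_coeff p]
  refine Submodule.sum_mem _ fun s hs => ?_
  have hdeg : s.degree ≤ 2 * d := by
    refine le_trans ?_ hp
    rw [Finsupp.degree_eq_sum]
    simpa [Finsupp.sum_fintype] using MvPolynomial.le_totalDegree hs
  -- Split the monomial into two factors of degree at most `d`, then polarize their product.
  obtain ⟨t, hts, ht⟩ := s.exists_le_degree_eq (min d s.degree) (min_le_right _ _)
  obtain ⟨u, rfl⟩ := le_iff_exists_add.1 hts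
  have hadd : (t + u).degree = t.degree + u.degree := map_add _ _ _
  have hmem : ∀ v : Fin n →₀ ℕ, v.degree ≤ d → ∀ c : ℝ,
      MvPolynomial.monomial v c ∈ polySpace n d := by
    intro v hv c
    rw [MvPolynomial.mem_restrictTotalDegree]
    refine (MvPolynomial.totalDegree_monomial_le v c).trans ?_
    rw [Finsupp.degree_eq_sum] at hv
    simpa [Finsupp.sum_fintype] using hv
  have h1 := hmem t (by omega) (MvPolynomial.coeff (t + u) p)
  have h2 := hmem u (by omega) 1
  set a := MvPolynomial.monomial t (MvPolynomial.coeff (t + u) p)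
  set b := MvPolynomial.monomial u (1 : ℝ)
  have hab : MvPolynomial.monomial (t + u) (MvPolynomial.coeff (t + u) p) =
      (1 / 2 : ℝ) • ((a + b) * (a + b) - a * a - b * b) := by
    rw [show (a + b) * (a + b) - a * a - b * b = (2 : ℝ) • (a * b) by rw [two_smul]; ring,
      smul_smul]
    norm_num [a, b, MvPolynomial.monomial_mul]
  rw [hab]
  exact Submodule.smul_mem _ _ (sub_mem (sub_mem (hsq _ (add_mem h1 h2)) (hsq _ h1)) (hsq _ h2))

/-! ### Weighted sums of squares. -/

instance finiteDimensional_weightedSpace {n m : ℕ} (g : Fin m → MvPolynomial (Fin n) ℝ)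
    (d : Fin m → ℕ) : FiniteDimensional ℝ (weightedSpace g d) := by
  let L : (∀ i, polySpace n (2 * d i)) →ₗ[ℝ] MvPolynomial (Fin n) ℝ :=
    ∑ i, (LinearMap.mulLeft ℝ (g i)) ∘ₗ (polySpace n (2 * d i)).subtype ∘ₗ LinearMap.proj i
  have hL : weightedSpace g d = LinearMap.range L := by
    ext p
    constructor
    · rintro ⟨r, hr, rfl⟩
      exact ⟨fun i => ⟨r i, hr i⟩, by simp [L]⟩
    · rintro ⟨r, rfl⟩
      exact ⟨fun i => r i, fun i => (r i).2, by simp [L]⟩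
  rw [hL]
  infer_instance

theorem mul_mem_weightedSpace {n m : ℕ} (g : Fin m → MvPolynomial (Fin n) ℝ) (d : Fin m → ℕ)
    (i : Fin m) {p : MvPolynomial (Fin n) ℝ} (hp : p ∈ polySpace n (2 * d i)) :
    g i * p ∈ weightedSpace g d := by
  refine ⟨Pi.single i p, fun j => ?_, ?_⟩
  · rcases eq_or_ne j i with rfl | h
    · simpa using hp
    · simp [h]
  · rw [Finset.sum_eq_single i (fun j _ h => by simp [h]) (by simp)]
    simp

/-- The bilinear map `(p, q) ↦ gᵢ p q` into the weighted space. -/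
noncomputable def weightedMul {n m : ℕ} (g : Fin m → MvPolynomial (Fin n) ℝ) (d : Fin m → ℕ)
    (i : Fin m) :
    polySpace n (d i) →ₗ[ℝ] polySpace n (d i) →ₗ[ℝ] weightedSpace g d :=
  LinearMap.mk₂ ℝ
    (fun p q => ⟨g i * (p * q), mul_mem_weightedSpace g d i (mul_mem_polySpace p.2 q.2)⟩)
    (fun _ _ _ => Subtype.ext (by simp; ring))
    (fun _ _ _ => Subtype.ext (by simp))
    (fun _ _ _ => Subtype.ext (by simp; ring))
    (fun _ _ _ => Subtype.ext (by simp))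

theorem coe_weightedMul {n m : ℕ} (g : Fin m → MvPolynomial (Fin n) ℝ) (d : Fin m → ℕ)
    (i : Fin m) (p q : polySpace n (d i)) :
    (weightedMul g d i p q : MvPolynomial (Fin n) ℝ) = g i * (p * q) := rfl

/-- Pointwise nonnegative values cannot cancel, and a real polynomial vanishing everywhere is zero.
-/
theorem sum_eq_zero_iff_of_mem_sosCone {n m : ℕ} {d : Fin m → ℕ}
    {s : Fin m → MvPolynomial (Fin n) ℝ} (hs : ∀ i, s i ∈ sosCone n (d i)) :
    ∑ i, s i = 0 ↔ ∀ i, s i = 0 := by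
  refine ⟨fun h i => MvPolynomial.funext fun x => ?_, fun h => Finset.sum_eq_zero fun i _ => h i⟩
  have := congrArg (MvPolynomial.eval x) h
  rw [map_sum, map_zero,
    Finset.sum_eq_zero_iff_of_nonneg fun j _ => eval_nonneg_of_mem_sosCone (hs j) x] at this
  rw [this i (Finset.mem_univ i), map_zero]

/-- The weighted sums of squares admitting a representation with nonzero total form a convex
set. -/
theorem convex_nontrivial_wsos {n m : ℕ} (g : Fin m → MvPolynomial (Fin n) ℝ) (d : Fin m → ℕ) :
    Convex ℝ {p : weightedSpace g d | ∃ s : Fin m → MvPolynomial (Fin n) ℝ,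
      (∀ i, s i ∈ sosCone n (d i)) ∧ (p : MvPolynomial (Fin n) ℝ) = ∑ i, g i * s i ∧
        ∑ i, s i ≠ 0} := by
  rintro p ⟨s, hs, hp, hs0⟩ q ⟨t, ht, hq, ht0⟩ a b ha hb hab
  have has : ∀ i, a • s i ∈ sosCone n (d i) := fun i => smul_mem_sosCone ha (hs i)
  have hbt : ∀ i, b • t i ∈ sosCone n (d i) := fun i => smul_mem_sosCone hb (ht i)
  have hst : ∀ i, a • s i + b • t i ∈ sosCone n (d i) := fun i => add_mem_sosCone (has i) (hbt i)
  refine ⟨fun i => a • s i + b • t i, hst, ?_, fun h => ?_⟩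
  · simp [hp, hq, Finset.smul_sum, mul_add, Finset.sum_add_distrib]
  rw [sum_eq_zero_iff_of_mem_sosCone hst] at h
  have key : ∀ i, a • s i = 0 ∧ b • t i = 0 := by
    intro i
    have : ∀ x, MvPolynomial.eval x (a • s i) = 0 ∧ MvPolynomial.eval x (b • t i) = 0 := by
      intro x
      have h1 := congrArg (MvPolynomial.eval x) (h i)
      rw [map_add, map_zero] at h1
      have h2 := eval_nonneg_of_mem_sosCone (has i) x
      have h3 := eval_nonneg_of_mem_sosCone (hbt i) x
      constructor <;> linarith
    exact ⟨MvPolynomial.funext fun x => by rw [(this x).1, map_zero],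
      MvPolynomial.funext fun x => by rw [(this x).2, map_zero]⟩
  -- One of the weights is positive, and its representation would then vanish.
  rcases ha.eq_or_lt with rfl | ha
  · obtain rfl : b = 1 := by linarith
    exact ht0 (Finset.sum_eq_zero fun i _ => by simpa using (key i).2)
  · exact hs0 (Finset.sum_eq_zero fun i _ => (smul_eq_zero.1 (key i).1).resolve_left ha.ne')

theorem wsosCone_eq_span {n m : ℕ} (g : Fin m → MvPolynomial (Fin n) ℝ) (d : Fin m → ℕ)
    {S : Set (weightedSpace g d)}
    (hS1 : ∀ x ∈ S, ∃ i, ∃ v : polySpace n (d i), v ≠ 0 ∧ x = weightedMul g d i v v)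
    (hS2 : ∀ i, ∀ v : polySpace n (d i), v ≠ 0 →
      ∃ c : ℝ, 0 < c ∧ ∃ x ∈ S, weightedMul g d i v v = c • x) :
    wsosCone g d = (Submodule.span {c : ℝ // 0 ≤ c} S : Set (weightedSpace g d)) := by
  ext p
  constructor
  · rintro ⟨s, hs, hp⟩
    choose _ M q hq hsq using hs
    have : p = ∑ i, ∑ j, weightedMul g d i ⟨q i j, hq i j⟩ ⟨q i j, hq i j⟩ := by
      apply Subtype.ext
      simp [hp, hsq, coe_weightedMul, Finset.mul_sum, sq]
    rw [this]
    refine sum_mem fun i _ => sum_mem fun j _ => ?_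
    generalize (⟨q i j, hq i j⟩ : polySpace n (d i)) = v
    by_cases hv : v = 0
    · simp [hv]
    · obtain ⟨c, hc, x, hx, h⟩ := hS2 i v hv
      rw [h]
      exact Submodule.smul_mem _ (⟨c, hc.le⟩ : {c : ℝ // 0 ≤ c}) (Submodule.subset_span hx)
  · intro hp
    induction hp using Submodule.span_induction with
    | mem x hx =>
      obtain ⟨i, v, -, rfl⟩ := hS1 x hx
      refine ⟨Pi.single i (v * v), fun j => ?_, ?_⟩
      · rcases eq_or_ne j i with rfl | h
        · simpa using sq_mem_sosCone v.2
        · simpa [h] using zero_mem_sosCone n (d j)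
      · rw [Finset.sum_eq_single i (fun j _ h => by simp [h]) (by simp)]
        simp [coe_weightedMul]
    | zero => exact ⟨0, fun i => zero_mem_sosCone n (d i), by simp⟩
    | add x y _ _ hx hy =>
      obtain ⟨s, hs, hx⟩ := hx
      obtain ⟨t, ht, hy⟩ := hy
      exact ⟨s + t, fun i => add_mem_sosCone (hs i) (ht i), by
        simp [hx, hy, mul_add, Finset.sum_add_distrib]⟩
    | smul c x _ hx =>
      obtain ⟨s, hs, hx⟩ := hx
      refine ⟨fun i => (c : ℝ) • s i, fun i => smul_mem_sosCone c.2 (hs i), ?_⟩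
      change (c : ℝ) • (x : MvPolynomial (Fin n) ℝ) = _
      simp only [hx, Finset.smul_sum, mul_smul_comm]

theorem span_eq_top_of_weightedMul {n m : ℕ} (g : Fin m → MvPolynomial (Fin n) ℝ)
    (d : Fin m → ℕ) {S : Set (weightedSpace g d)}
    (hS2 : ∀ i, ∀ v : polySpace n (d i), v ≠ 0 →
      ∃ c : ℝ, 0 < c ∧ ∃ x ∈ S, weightedMul g d i v v = c • x) :
    Submodule.span ℝ S = ⊤ := by
  have key : weightedSpace g d ≤ (Submodule.span ℝ S).map (weightedSpace g d).subtype := by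
    rintro _ ⟨r, hr, rfl⟩
    refine Submodule.sum_mem _ fun i _ => ?_
    -- The preimage under multiplication by `g i` is a submodule, so squares suffice.
    suffices h : polySpace n (2 * d i) ≤ ((Submodule.span ℝ S).map
        (weightedSpace g d).subtype).comap (LinearMap.mulLeft ℝ (g i)) from h (hr i)
    refine (polySpace_two_mul_le_span_sq n (d i)).trans (Submodule.span_le.2 ?_)
    rintro _ ⟨q, hq, hq0, rfl⟩
    obtain ⟨c, -, x, hx, h⟩ := hS2 i ⟨q, hq⟩ (by simpa [Subtype.ext_iff] using hq0)
    refine ⟨_, Submodule.smul_mem _ c (Submodule.subset_span hx), ?_⟩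
    rw [← h]
    rfl
  refine eq_top_iff.2 fun x _ => ?_
  obtain ⟨y, hy, hyx⟩ := key x.2
  rwa [← Subtype.ext hyx]

theorem isProperCone_wsosCone {n m : ℕ} (g : Fin m → MvPolynomial (Fin n) ℝ) (d : Fin m → ℕ)
    (h : ¬ ∃ s : Fin m → MvPolynomial (Fin n) ℝ,
      (∀ i, s i ∈ sosCone n (d i)) ∧ ∑ i, g i * s i = 0 ∧ ∑ i, s i ≠ 0) :
    IsProperCone (wsosCone g d) := by
  obtain ⟨S, h1, h2, hproper⟩ := LinearMap.exists_isProperCone_span_diagonal (weightedMul g d)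
  rw [wsosCone_eq_span g d h1 h2]
  refine hproper (fun h0 => h ?_) (span_eq_top_of_weightedMul g d h2)
  have hmem := convexHull_min ?_ (convex_nontrivial_wsos g d) h0
  · obtain ⟨s, hs, hs0, hne⟩ := hmem
    exact ⟨s, hs, hs0.symm, hne⟩
  · intro x hx
    obtain ⟨i, v, hv, rfl⟩ := h1 x hx
    refine ⟨Pi.single i (v * v), fun j => ?_, ?_, ?_⟩
    · rcases eq_or_ne j i with rfl | h
      · simpa using sq_mem_sosCone v.2
      · simpa [h] using zero_mem_sosCone n (d j)
    · rw [Finset.sum_eq_single i (fun j _ h => by simp [h]) (by simp)]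
      simp [coe_weightedMul]
    · simpa using hv

theorem proposition6p1 (n m : ℕ) (g : Fin m → MvPolynomial (Fin n) ℝ) (hg : ∀ i, g i ≠ 0)
    (d : Fin m → ℕ) :
    IsProperCone (wsosCone g d) ↔
      ¬ ∃ s : Fin m → MvPolynomial (Fin n) ℝ,
        (∀ i, s i ∈ sosCone n (d i)) ∧ ∑ i, g i * s i = 0 ∧ ∑ i, s i ≠ 0 := by
  refine ⟨?_, isProperCone_wsosCone g d⟩
  rintro hK ⟨s, hs, hs0, hne⟩
  refine hne (Finset.sum_eq_zero fun i _ => ?_)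
  let x : weightedSpace g d := ⟨g i * s i, mul_mem_weightedSpace g d i (hs i).1⟩
  have hx : x ∈ wsosCone g d := by
    refine ⟨Pi.single i (s i), fun j => ?_, ?_⟩
    · rcases eq_or_ne j i with rfl | h
      · simpa using hs j
      · simpa [h] using zero_mem_sosCone n (d j)
    · rw [Finset.sum_eq_single i (fun j _ h => by simp [h]) (by simp)]
      simp [x]
  have hx' : -x ∈ wsosCone g d := by
    -- Dropping the `i`-th term of the vanishing sum leaves `-(g i * s i)`.
    refine ⟨Function.update s i 0, fun j => ?_, ?_⟩
    · rcases eq_or_ne j i with rfl | h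
      · simpa using zero_mem_sosCone n (d j)
      · simpa [h] using hs j
    · rw [← Finset.add_sum_erase _ _ (Finset.mem_univ i)] at hs0 ⊢
      rw [Finset.sum_congr rfl fun j hj =>
        show g j * Function.update s i 0 j = g j * s j by simp [Finset.ne_of_mem_erase hj]]
      simpa [x] using neg_eq_of_add_eq_zero_right hs0
  have := congrArg Subtype.val (hK.pointed x hx hx')
  exact (mul_eq_zero.1 this).resolve_left (hg i)
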